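/- Let $\mathcal A$ be a finite set of $n$ agents, and let $\mathcal P = (p_{ij})_{i \neq j \in \mathcal A}$ be a preference profile, where the real number $p_{ij}$ is the utility that agent $i$ gains from sitting next to agent $j$ (symmetry $p_{ij} = p_{ji}$ is not assumed). Let $C_n$ be the cycle with $n$ seats. An arrangement on $C_n$ is a bijection $\pi$ from $\mathcal A$ to the seats; the utility of agent $i$ in $\pi$ is $U_i(\pi) = \sum_{v \in N(\pi(i))} p_{i\,\pi^{-1}(v)}$, where $N(\pi(i))$ is the set of seats adjacent to the seat of $i$. Agent $i$ envies agent $j$ in $\pi$ if $U_i(\pi) < U_i(\pi')$, where $\pi'$ is $\pi$ with the seats of $i$ and $j$ exchanged. The arrangement $\pi$ is stable if no two agents envy each other. The profile is two-valued if there is a set $\Gamma$ of two real numbers with $p_{ij} \in \Gamma$ for all $i \neq j$. A class is a set $\mathcal C \subseteq \mathcal A$ of indistinguishable agents: the members of $\mathcal C$ share a common preference function $p_{\mathcal C} \colon \mathcal A \to \mathbb R$, i.e. $p_{ij} = p_{\mathcal C}(j)$ for all $i \in \mathcal C$ and $j \neq i$, which is constant on $\mathcal C$, and for every agent $a \notin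 \mathcal C$ the value $p_{aj}$ is the same for all $j \in \mathcal C$. The profile is a three-class profile if $\mathcal A$ can be partitioned into three (possibly empty) classes. **Theorem.** Every three-class two-valued preference profile, with arbitrary real values, has a stable arrangement on a cycle. -/

import Mathlib

namespace Seating

/-- A preference profile on a set `A` of agents: `P i j` is the utility that agent `i` gains from
sitting next to agent `j`. The diagonal entries `P i i` carry no meaning; no definition below
depends on them as long as the seating graph is loopless. -/
abbrev Profile (A : Type*) := A → A → ℝ

/-- The profile is `k`-valued: all its off-diagonal entries lie in a set of `k` real numbers. -/
def Profile.IsValued {A : Type*} (P : Profile A) (k : ℕ) : Prop :=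
  ∃ Γ : Finset ℝ, Γ.card = k ∧ ∀ i j : A, i ≠ j → P i j ∈ Γ

/-- `C` is a class of indistinguishable agents: its members share a common preference function
`p : A → ℝ` (defined on all of `A`, also on `C` itself), and no agent, inside or outside of `C`,
discriminates between two members of `C`. -/
def Profile.IsClass {A : Type*} (P : Profile A) (C : Set A) : Prop :=
  (∃ p : A → ℝ, (∀ i ∈ C, ∀ j, j ≠ i → P i j = p j) ∧ ∀ j ∈ C, ∀ j' ∈ C, p j = p j') ∧
    ∀ a ∉ C, ∀ j ∈ C, ∀ j' ∈ C, P a j = P a j'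

/-- The set of agents can be partitioned into `k` classes, the fibres of `c`. Fibres may be empty,
so that profiles with fewer than `k` classes are covered too. -/
def Profile.HasClasses {A : Type*} (P : Profile A) (k : ℕ) : Prop :=
  ∃ c : A → Fin k, ∀ t : Fin k, P.IsClass {i | c i = t}

/-- The utility of agent `i` in the arrangement `π` on the seating graph `G`: the sum of the
preferences of `i` for the occupants of the seats adjacent to the seat of `i`. -/
noncomputable def utility {A V : Type*} [Fintype V] (P : Profile A) (G : SimpleGraph V)
    [DecidableRel G.Adj] (π : A ≃ V) (i : A) : ℝ :=
  ∑ v ∈ G.neighborFinset (π i), P i (π.symm v)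

/-- The arrangement `π` with the seats of `i` and `j` exchanged. -/
def swapSeats {A V : Type*} [DecidableEq A] (π : A ≃ V) (i j : A) : A ≃ V :=
  (Equiv.swap i j).trans π

/-- Agent `i` envies agent `j`: exchanging seats with `j` would strictly increase the utility
of `i`. -/
def Envies {A V : Type*} [DecidableEq A] [Fintype V] (P : Profile A) (G : SimpleGraph V)
    [DecidableRel G.Adj] (π : A ≃ V) (i j : A) : Prop :=
  utility P G π i < utility P G (swapSeats π i j) i

/-- The pair `(i, j)` is blocking: `i` and `j` envy each other. -/
def IsBlockingPair {A V : Type*} [DecidableEq A] [Fintype V] (P : Profile A) (G : SimpleGraph V)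
    [DecidableRel G.Adj] (π : A ≃ V) (i j : A) : Prop :=
  Envies P G π i j ∧ Envies P G π j i

/-- The arrangement `π` is stable: it has no blocking pair. -/
def IsStable {A V : Type*} [DecidableEq A] [Fintype V] (P : Profile A) (G : SimpleGraph V)
    [DecidableRel G.Adj] (π : A ≃ V) : Prop :=
  ∀ i j : A, ¬ IsBlockingPair P G π i j

end Seating

/-!
On at most two seats there is nothing to prove. On more seats, after an affine change of the
utilities, which is harmless since all seats have two neighbours, the preferences of the three classes form a matrix `M` with entries `0` and `1`, and an arrangement is a
cyclic word in the classes `0`, `1`, `2`. Two members of one class never block. The members `i`, `j`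
of different classes `s`, `t` block if the neighbours of `j` are better for `s` than those of `i`,
and worse for `t`. Entries of `M` that describe no two agents may be chosen at will.

Suppose that a symmetric matrix `φ` of interactions is such that, for all `s ≠ t`, every such move
increases `φ s - φ t`. Then every exchange along a blocking pair increases the sum of `φ` over the
pairs of neighbours, and an arrangement maximizing this sum is stable
(`exists_wordStable_of_potential`). For instance this is the case if each `φ s - φ t` agrees, up to
a constant, with `w s * M s - w t * M t` for some positive weights `w`. With the differences
`d s = M s (s + 1) - M s (s + 2)`, the indices being read modulo `3`, a symmetric `φ` of this kind
exists if and only if `w 0 * d 0 + w 1 * d 1 + w 2 * d 2 = 0`. Such weights exist if the `d s` do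
not vanish and have different signs (`exists_wordStable_of_balanced`). If some `d s` vanishes, then
the class `s` distinguishes at most its own members from all others; a large self-interaction of
this class takes care of all pairs with a member of `s`, and the remaining entries of `φ` are free
to be adapted to the other two classes (`exists_wordStable_of_eq`).

There remains the cyclic case, in which each class likes the next one and does not like the previous
one (`exists_wordStable_of_cyclic`). Exchanges along blocking pairs may then run in circles, but
there are explicit stable words, depending on which of the classes like themselves and on the sizes
of the classes. They are given as cyclic walks in small labelled digraphs. Stability only involves
the neighbours of two agents, so it can be checked on the walks of length two and three
(`exists_wordStable_of_leads`).
-/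

namespace Seating

/-! ### Stability as a property of the word of classes -/

/-- Local stability of the word `w`, written cyclically on `m + 3` seats, for agents whose class `s`
values class `t` at `M s t`. Two agents on non-adjacent seats do not both prefer the neighbours of
the other, and two agents on adjacent seats `p`, `p + 1` do not both prefer the outer neighbour of
the other (they remain neighbours of each other after the exchange). -/
def WordStable {κ : Type*} {m : ℕ} (M : κ → κ → ℤ) (w : Fin (m + 3) → κ) : Prop :=
  (∀ p q, w p ≠ w q → q ≠ p + 1 → p ≠ q + 1 →
    ¬ (M (w p) (w (p - 1)) + M (w p) (w (p + 1)) < M (w p) (w (q - 1)) + M (w p) (w (q + 1)) ∧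
       M (w q) (w (q - 1)) + M (w q) (w (q + 1)) < M (w q) (w (p - 1)) + M (w q) (w (p + 1)))) ∧
  (∀ p, w p ≠ w (p + 1) →
    ¬ (M (w p) (w (p - 1)) < M (w p) (w (p + 1 + 1)) ∧
       M (w (p + 1)) (w (p + 1 + 1)) < M (w (p + 1)) (w (p - 1))))

section FinArith
variable {m : ℕ}

theorem fin_add_one_ne (p : Fin (m + 3)) : p + 1 ≠ p := by
  intro h
  simp at h

theorem fin_sub_one_ne (p : Fin (m + 3)) : p - 1 ≠ p := by
  intro h
  have := fin_add_one_ne (p - 1)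
  rw [sub_add_cancel] at this
  exact this h.symm

theorem fin_add_two_ne (p : Fin (m + 3)) : p + 1 + 1 ≠ p := by
  intro h
  have h1 : (1 + 1 : Fin (m + 3)) = 0 := by simpa [add_assoc] using h
  simp [Fin.ext_iff, Fin.val_add] at h1
  rw [Nat.mod_eq_of_lt (by omega)] at h1
  omega

theorem fin_sub_one_ne_add_one (p : Fin (m + 3)) : p - 1 ≠ p + 1 := by
  intro h
  have := fin_add_two_ne (p - 1)
  rw [sub_add_cancel] at this
  exact this h.symm

end FinArith

theorem utility_cycle {A : Type*} {m : ℕ} (P : Profile A) (π : A ≃ Fin (m + 3)) (i : A) :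
    utility P (SimpleGraph.cycleGraph (m + 3)) π i =
      P i (π.symm (π i - 1)) + P i (π.symm (π i + 1)) := by
  unfold utility
  rw [SimpleGraph.cycleGraph_neighborFinset, Finset.sum_pair (fin_sub_one_ne_add_one _)]

theorem swapSeats_self {A V : Type*} [DecidableEq A] (π : A ≃ V) (i : A) :
    swapSeats π i i = π := by
  simp [swapSeats]

/-- For utilities `x + (y - x) * M s t` with `x < y`, an arrangement is stable as soon as its word
of classes is. -/
theorem isStable_of_wordStable {A κ : Type*} [DecidableEq A] {m : ℕ} {P : Profile A} {c : A → κ}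
    {M : κ → κ → ℤ} {x y : ℝ} (hxy : x < y)
    (hP : ∀ i j, i ≠ j → P i j = x + (y - x) * M (c i) (c j)) (π : A ≃ Fin (m + 3))
    (hw : WordStable M (c ∘ π.symm)) :
    IsStable P (SimpleGraph.cycleGraph (m + 3)) π := by
  -- comparisons of utilities are comparisons of sums of entries of `M`
  have key : ∀ a b d e : ℤ,
      x + (y - x) * (a : ℝ) + (x + (y - x) * b) < x + (y - x) * d + (x + (y - x) * e) →
        a + b < d + e := by
    intro a b d e h
    have h2 : (y - x) * ((a + b : ℤ) : ℝ) < (y - x) * ((d + e : ℤ) : ℝ) := by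
      push_cast; linarith
    exact_mod_cast lt_of_mul_lt_mul_left h2 (by linarith)
  have hu : ∀ (ρ : A ≃ Fin (m + 3)) (i : A),
      utility P (SimpleGraph.cycleGraph (m + 3)) ρ i =
        x + (y - x) * M (c i) (c (ρ.symm (ρ i - 1))) +
          (x + (y - x) * M (c i) (c (ρ.symm (ρ i + 1)))) := by
    intro ρ i
    rw [utility_cycle, hP, hP]
    · intro h
      apply fin_add_one_ne (ρ i)
      conv_rhs => rw [h]
      simp
    · intro h
      apply fin_sub_one_ne (ρ i)
      conv_rhs => rw [h]
      simp
  intro i j ⟨h1, h2⟩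
  unfold Envies at h1 h2
  have hij : i ≠ j := by
    rintro rfl
    rw [swapSeats_self] at h1
    exact lt_irrefl _ h1
  rw [hu, hu] at h1 h2
  replace h1 := key _ _ _ _ h1
  replace h2 := key _ _ _ _ h2
  have e1 : ∀ r, (swapSeats π i j).symm r = Equiv.swap i j (π.symm r) := fun r => rfl
  have e1' : ∀ r, (swapSeats π j i).symm r = Equiv.swap i j (π.symm r) := fun r => by
    rw [Equiv.swap_comm]; rfl
  have e2 : swapSeats π i j i = π j := by simp [swapSeats]
  have e3 : swapSeats π j i j = π i := by simp [swapSeats]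
  simp only [e1, e1', e2, e3] at h1 h2
  obtain ⟨p, rfl⟩ := π.symm.surjective i
  obtain ⟨q, rfl⟩ := π.symm.surjective j
  have hpq : p ≠ q := fun h => hij (by rw [h])
  simp only [Equiv.apply_symm_apply] at h1 h2
  have sw : ∀ r, r ≠ p → r ≠ q → Equiv.swap (π.symm p) (π.symm q) (π.symm r) = π.symm r :=
    fun r hp hq => Equiv.swap_apply_of_ne_of_ne (by simpa using hp) (by simpa using hq)
  obtain ⟨hw1, hw2⟩ := hw
  simp only [Function.comp] at hw1 hw2
  -- members of one class that exchange their seats exchange their utilities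
  by_cases hc : c (π.symm p) = c (π.symm q)
  · have hs : ∀ z, c (Equiv.swap (π.symm p) (π.symm q) z) = c z := by
      intro z
      rcases eq_or_ne z (π.symm p) with rfl | hz
      · rw [Equiv.swap_apply_left, hc]
      rcases eq_or_ne z (π.symm q) with rfl | hz'
      · rw [Equiv.swap_apply_right, hc]
      rw [Equiv.swap_apply_of_ne_of_ne hz hz']
    simp only [hs] at h1 h2
    rw [hc] at h1
    exact lt_asymm h1 h2
  · rcases eq_or_ne q (p + 1) with rfl | hq
    · have n1 := fin_add_two_ne p
      have n2 := fin_add_one_ne (p + 1)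
      have n3 := fin_sub_one_ne p
      have n4 := fin_sub_one_ne_add_one p
      simp only [add_sub_cancel_right, Equiv.swap_apply_left, Equiv.swap_apply_right,
        sw _ n1 n2, sw _ n3 n4] at h1 h2
      exact hw2 p hc ⟨by linarith, by linarith⟩
    rcases eq_or_ne p (q + 1) with rfl | hp
    · have n1 := fin_add_two_ne q
      have n2 := fin_add_one_ne (q + 1)
      have n3 := fin_sub_one_ne q
      have n4 := fin_sub_one_ne_add_one q
      simp only [add_sub_cancel_right, Equiv.swap_apply_left, Equiv.swap_apply_right,
        sw _ n2 n1, sw _ n4 n3] at h1 h2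
      exact hw2 q (Ne.symm hc) ⟨by linarith, by linarith⟩
    · have a1 : q - 1 ≠ p := fun h => hq (by rw [← h, sub_add_cancel])
      have a2 : p - 1 ≠ q := fun h => hp (by rw [← h, sub_add_cancel])
      rw [sw _ a1 (fin_sub_one_ne q), sw _ hp.symm (fin_add_one_ne q)] at h1
      rw [sw _ (fin_sub_one_ne p) a2, sw _ (fin_add_one_ne p) hq.symm] at h2
      exact hw1 p q hc hq hp ⟨h1, h2⟩

/-- On at most two seats every arrangement is stable: exchanging seats changes nothing. -/
theorem isStable_cycleGraph_of_lt_three {A : Type*} [DecidableEq A] {n : ℕ} (hn : n < 3)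
    (P : Profile A) (π : A ≃ Fin n) : IsStable P (SimpleGraph.cycleGraph n) π := by
  intro i j ⟨h1, h2⟩
  unfold Envies at h1 h2
  have hij : i ≠ j := by
    rintro rfl
    rw [swapSeats_self] at h1
    exact lt_irrefl _ h1
  have hπ : π i ≠ π j := fun h => hij (π.injective h)
  interval_cases n
  · exact (π i).elim0
  · exact hπ (Subsingleton.elim _ _)
  · have hd : ∀ a b : Fin 2, a ≠ b → a - 1 = b ∧ a + 1 = b := by decide
    have hu : ∀ (ρ : A ≃ Fin 2) (k l : A), k ≠ l →
        utility P (SimpleGraph.cycleGraph 2) ρ k = P k l := by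
      intro ρ k l hkl
      unfold utility
      obtain ⟨e1, e2⟩ := hd (ρ k) (ρ l) (fun h => hkl (ρ.injective h))
      rw [SimpleGraph.cycleGraph_neighborFinset, e1, e2]
      simp
    rw [hu _ i j hij, hu _ i j hij] at h1
    exact lt_irrefl _ h1

/-! ### The potential method -/

/-- The energy of the word `w`: every seat contributes the interaction `φ` of its occupant with both
neighbours, so that every pair of adjacent seats is counted twice. -/
def energy {κ : Type*} {m : ℕ} (φ : κ → κ → ℤ) (w : Fin (m + 3) → κ) : ℤ :=
  ∑ i, (φ (w i) (w (i - 1)) + φ (w i) (w (i + 1)))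

/-- Summation by parts on the cycle: a bilinear form may be summed over either end of an edge. -/
theorem sum_neighbors_comm {κ : Type*} {m : ℕ} (φ : κ → κ → ℤ) (u v : Fin (m + 3) → κ) :
    ∑ i, (φ (u i) (v (i - 1)) + φ (u i) (v (i + 1))) =
      ∑ i, (φ (u (i - 1)) (v i) + φ (u (i + 1)) (v i)) := by
  rw [Finset.sum_add_distrib, Finset.sum_add_distrib, add_comm]
  congr 1
  · exact Fintype.sum_equiv (Equiv.addRight 1) _ _ (fun i => by simp)
  · exact Fintype.sum_equiv (Equiv.subRight 1) _ _ (fun i => by simp)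

/-- The energy change when the occupants of the seats `p` and `q` are exchanged. It is expressed by
the differences of the interactions of these occupants with their neighbours, both before and after
the exchange, which covers adjacent and non-adjacent seats alike. -/
theorem energy_swap {κ : Type*} {m : ℕ} {φ : κ → κ → ℤ} (hφ : ∀ s t, φ s t = φ t s)
    (w : Fin (m + 3) → κ) {p q : Fin (m + 3)} (hpq : p ≠ q) (w' : Fin (m + 3) → κ)
    (hw' : w' = w ∘ Equiv.swap p q) (g : κ → ℤ) (hg : ∀ v, g v = φ (w p) v - φ (w q) v) :
    energy φ w' = energy φ w +
      (g (w' (q - 1)) + g (w' (q + 1)) + g (w (q - 1)) + g (w (q + 1))) -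
      (g (w' (p - 1)) + g (w' (p + 1)) + g (w (p - 1)) + g (w (p + 1))) := by
  have wp : w' p = w q := by simp [hw']
  have wq : w' q = w p := by simp [hw']
  have wr : ∀ r, r ≠ p → r ≠ q → w' r = w r := fun r h1 h2 => by
    simp [hw', Equiv.swap_apply_of_ne_of_ne h1 h2]
  have h1 : energy φ w = ∑ i, (φ (w i) (w (i - 1)) + φ (w i) (w (i + 1))) := rfl
  have h2 : energy φ w' = ∑ i, (φ (w' i) (w' (i - 1)) + φ (w' i) (w' (i + 1))) := rfl
  -- the mixed sum in which one end of every edge is read in `w`, the other one in `w'`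
  have h3 : ∑ i, (φ (w i) (w' (i - 1)) + φ (w i) (w' (i + 1))) =
      ∑ i, (φ (w' i) (w (i - 1)) + φ (w' i) (w (i + 1))) := by
    rw [sum_neighbors_comm]
    exact Finset.sum_congr rfl fun i _ => by rw [hφ (w (i - 1)), hφ (w (i + 1))]
  have h4 : energy φ w' - energy φ w = ∑ i,
      ((φ (w' i) (w' (i - 1)) - φ (w i) (w' (i - 1))) +
       (φ (w' i) (w' (i + 1)) - φ (w i) (w' (i + 1))) +
       (φ (w' i) (w (i - 1)) - φ (w i) (w (i - 1))) +
       (φ (w' i) (w (i + 1)) - φ (w i) (w (i + 1)))) := by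
    rw [h1, h2]
    simp only [Finset.sum_add_distrib, Finset.sum_sub_distrib] at h3 ⊢
    linarith
  rw [← Finset.sum_subset (Finset.subset_univ {p, q}), Finset.sum_pair hpq] at h4
  · simp only [wp, wq, hg] at h4 ⊢
    linarith
  · intro r _ hr
    simp only [Finset.mem_insert, Finset.mem_singleton, not_or] at hr
    rw [wr r hr.1 hr.2]
    ring

/-- The potential method. If, for any two classes `s` and `t`, a move that improves the neighbours
for `s` and worsens them for `t` increases `φ s - φ t`, then every exchange along a blocking pair
increases the energy of `φ`; hence an arrangement of maximal energy is stable. -/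
theorem exists_wordStable_of_potential {A κ : Type*} [Finite A] {m : ℕ} {c : A → κ}
    {M φ : κ → κ → ℤ} (hA : Nonempty (A ≃ Fin (m + 3))) (hφ : ∀ s t, φ s t = φ t s)
    (h : ∀ s t, s ≠ t → ∀ a b a' b', M s a + M s b < M s a' + M s b' →
      M t a' + M t b' < M t a + M t b →
      φ s a - φ t a + (φ s b - φ t b) < φ s a' - φ t a' + (φ s b' - φ t b')) :
    ∃ π : A ≃ Fin (m + 3), WordStable M (c ∘ π.symm) := by
  obtain ⟨π, hπ⟩ := Finite.exists_max fun π : A ≃ Fin (m + 3) => energy φ (c ∘ π.symm)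
  refine ⟨π, ?_⟩
  set w : Fin (m + 3) → κ := c ∘ π.symm with hw
  have hmax : ∀ p q, energy φ (w ∘ Equiv.swap p q) ≤ energy φ w := fun p q =>
    hπ (π.trans (Equiv.swap p q))
  constructor
  · intro p q hs hq hp ⟨h1, h2⟩
    have hpq : p ≠ q := fun h => hs (by rw [h])
    have e := energy_swap hφ w hpq _ rfl (fun v => φ (w p) v - φ (w q) v) (fun _ => rfl)
    have a1 : q - 1 ≠ p := fun h => hq (by rw [← h, sub_add_cancel])
    have a2 : p - 1 ≠ q := fun h => hp (by rw [← h, sub_add_cancel])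
    simp only [Function.comp, Equiv.swap_apply_of_ne_of_ne a1 (fin_sub_one_ne q),
      Equiv.swap_apply_of_ne_of_ne hp.symm (fin_add_one_ne q),
      Equiv.swap_apply_of_ne_of_ne (fin_sub_one_ne p) a2,
      Equiv.swap_apply_of_ne_of_ne (fin_add_one_ne p) hq.symm] at e
    have := h _ _ hs _ _ _ _ h1 h2
    have := hmax p q
    linarith
  · intro p hs ⟨h1, h2⟩
    have hpq := (fin_add_one_ne p).symm
    have e := energy_swap hφ w hpq _ rfl (fun v => φ (w p) v - φ (w (p + 1)) v) (fun _ => rfl)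
    simp only [Function.comp, add_sub_cancel_right, Equiv.swap_apply_left, Equiv.swap_apply_right,
      Equiv.swap_apply_of_ne_of_ne (fin_add_two_ne p) (fin_add_one_ne (p + 1)),
      Equiv.swap_apply_of_ne_of_ne (fin_sub_one_ne p) (fin_sub_one_ne_add_one p)] at e
    have := h _ _ hs (w (p - 1)) (w (p - 1)) (w (p + 1 + 1)) (w (p + 1 + 1))
      (by linarith) (by linarith)
    have := hmax p (p + 1)
    linarith

/-- If some class makes no difference between the other two classes, there is a potential. The
interaction is diagonal; up to constants `φ 1 - φ 2` is `M 1 - M 2`, and the self-interaction of the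
class `0` is so large that `φ 0 - φ t` follows `M 0`. -/
theorem exists_wordStable_of_eq {A : Type*} [Finite A] {m : ℕ} {c : A → Fin 3}
    {M : Fin 3 → Fin 3 → ℤ} (hA : Nonempty (A ≃ Fin (m + 3)))
    (hM : ∀ s t, 0 ≤ M s t ∧ M s t ≤ 1) (h0 : M 0 1 = M 0 2) :
    ∃ π : A ≃ Fin (m + 3), WordStable M (c ∘ π.symm) := by
  obtain ⟨x, hx⟩ : ∃ x : Fin 3 → ℤ, x = ![9 * (M 0 0 - M 0 1),
    (M 1 1 - M 1 0) - (M 2 1 - M 2 0), (M 2 2 - M 2 0) - (M 1 2 - M 1 0)] := ⟨_, rfl⟩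
  have x0 : x 0 = 9 * (M 0 0 - M 0 1) := by rw [hx]; rfl
  have x1 : x 1 = (M 1 1 - M 1 0) - (M 2 1 - M 2 0) := by rw [hx]; rfl
  have x2 : x 2 = (M 2 2 - M 2 0) - (M 1 2 - M 1 0) := by rw [hx]; rfl
  have b00 := hM 0 0
  have b01 := hM 0 1
  have b10 := hM 1 0
  have b11 := hM 1 1
  have b12 := hM 1 2
  have b20 := hM 2 0
  have b21 := hM 2 1
  have b22 := hM 2 2
  clear hx
  have g01 : ∀ v, |Matrix.diagonal x 0 v - Matrix.diagonal x 1 v - 9 * (M 0 v - M 0 1)| ≤ 2 := by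
    intro v
    rw [abs_le]
    fin_cases v <;> simp [Matrix.diagonal] <;> omega
  have g02 : ∀ v, |Matrix.diagonal x 0 v - Matrix.diagonal x 2 v - 9 * (M 0 v - M 0 1)| ≤ 2 := by
    intro v
    rw [abs_le]
    fin_cases v <;> simp [Matrix.diagonal] <;> omega
  have g12 : ∀ v, Matrix.diagonal x 1 v - Matrix.diagonal x 2 v =
      M 1 v - M 2 v - (M 1 0 - M 2 0) := by
    intro v
    fin_cases v <;> simp [Matrix.diagonal] <;> omega
  refine exists_wordStable_of_potential (φ := Matrix.diagonal x) hA
    (fun s t => by rw [← Matrix.transpose_apply (Matrix.diagonal x), Matrix.diagonal_transpose]) ?_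
  intro s t hst a b a' b' h1 h2
  have ha := g01 a
  have hb := g01 b
  have ha' := g01 a'
  have hb' := g01 b'
  have ka := g02 a
  have kb := g02 b
  have ka' := g02 a'
  have kb' := g02 b'
  have la := g12 a
  have lb := g12 b
  have la' := g12 a'
  have lb' := g12 b'
  rw [abs_le] at ha hb ha' hb' ka kb ka' kb'
  clear g01 g02 g12
  fin_cases s <;> fin_cases t <;> simp at hst h1 h2 ⊢ <;> omega

/-- If the preferences of class `0` between the other two classes are opposed to those of the
classes `1` and `2` in the cyclic sense, there is a potential: a diagonal interaction for which
`φ s - φ t` is, up to a constant, `M s` minus `M t` with weight `2` on the class `0`. -/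
theorem exists_wordStable_of_balanced {A : Type*} [Finite A] {m : ℕ} {c : A → Fin 3}
    {M : Fin 3 → Fin 3 → ℤ} (hA : Nonempty (A ≃ Fin (m + 3)))
    (h0 : 2 * (M 0 1 - M 0 2) + (M 1 2 - M 1 0) + (M 2 0 - M 2 1) = 0) :
    ∃ π : A ≃ Fin (m + 3), WordStable M (c ∘ π.symm) := by
  obtain ⟨x, hx⟩ : ∃ x : Fin 3 → ℤ, x = ![2 * (M 0 0 - M 0 2) - (M 1 0 - M 1 2),
    (M 1 1 - M 1 2) - 2 * (M 0 1 - M 0 2), (M 2 2 - M 2 1) - 2 * (M 0 2 - M 0 1)] := ⟨_, rfl⟩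
  have x0 : x 0 = 2 * (M 0 0 - M 0 2) - (M 1 0 - M 1 2) := by rw [hx]; rfl
  have x1 : x 1 = (M 1 1 - M 1 2) - 2 * (M 0 1 - M 0 2) := by rw [hx]; rfl
  have x2 : x 2 = (M 2 2 - M 2 1) - 2 * (M 0 2 - M 0 1) := by rw [hx]; rfl
  clear hx
  have g01 : ∀ v, Matrix.diagonal x 0 v - Matrix.diagonal x 1 v =
      2 * M 0 v - M 1 v - (2 * M 0 2 - M 1 2) := by
    intro v
    fin_cases v <;> simp [Matrix.diagonal] <;> omega
  have g02 : ∀ v, Matrix.diagonal x 0 v - Matrix.diagonal x 2 v =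
      2 * M 0 v - M 2 v - (2 * M 0 1 - M 2 1) := by
    intro v
    fin_cases v <;> simp [Matrix.diagonal] <;> omega
  have g12 : ∀ v, Matrix.diagonal x 1 v - Matrix.diagonal x 2 v =
      M 1 v - M 2 v - (M 1 0 - M 2 0) := by
    intro v
    fin_cases v <;> simp [Matrix.diagonal] <;> omega
  refine exists_wordStable_of_potential (φ := Matrix.diagonal x) hA
    (fun s t => by rw [← Matrix.transpose_apply (Matrix.diagonal x), Matrix.diagonal_transpose]) ?_
  intro s t hst a b a' b' h1 h2
  have ha := g01 a
  have hb := g01 b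
  have ha' := g01 a'
  have hb' := g01 b'
  have ka := g02 a
  have kb := g02 b
  have ka' := g02 a'
  have kb' := g02 b'
  have la := g12 a
  have lb := g12 b
  have la' := g12 a'
  have lb' := g12 b'
  clear g01 g02 g12
  fin_cases s <;> fin_cases t <;> simp at hst h1 h2 ⊢ <;> omega

/-! ### Words as cyclic walks -/

/-- The class of a label: a label is a class together with a tag, which records where in a word an
agent of that class sits. -/
abbrev Label := Fin 3 × ℕ

/-- The list `l` of labels continues a walk that has arrived at the label `x`; `E` is the list of
the permitted steps. -/
def Walk (E : List (Label × Label)) : Label → List Label → Prop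
  | _, [] => True
  | x, y :: l => (x, y) ∈ E ∧ Walk E y l

/-- Reading `l` from any label of `S` is a walk along `E`, and it arrives in `T`. -/
def Leads (E : List (Label × Label)) (S : List Label) (l : List Label) (T : List Label) : Prop :=
  ∀ x ∈ S, Walk E x l ∧ l.getLastD x ∈ T

instance decidableWalk (E : List (Label × Label)) : ∀ x l, Decidable (Walk E x l)
  | _, [] => isTrue trivial
  | x, y :: l =>
    have := decidableWalk E y l
    inferInstanceAs (Decidable ((x, y) ∈ E ∧ Walk E y l))

instance (E : List (Label × Label)) (S l T : List Label) : Decidable (Leads E S l T) :=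
  inferInstanceAs (Decidable (∀ x ∈ S, Walk E x l ∧ l.getLastD x ∈ T))

theorem walk_append {E : List (Label × Label)} {x : Label} {l l' : List Label} :
    Walk E x (l ++ l') ↔ Walk E x l ∧ Walk E (l.getLastD x) l' := by
  induction l generalizing x with
  | nil => simp [Walk]
  | cons y l ih => simp only [List.cons_append, Walk, ih, List.getLastD_cons, and_assoc]

theorem getLastD_append' (l l' : List Label) (x : Label) :
    (l ++ l').getLastD x = l'.getLastD (l.getLastD x) := by
  induction l generalizing x with
  | nil => rfl
  | cons y l ih => simp only [List.cons_append, List.getLastD_cons, ih]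

theorem Leads.append {E : List (Label × Label)} {S T U l l' : List Label} (h : Leads E S l T)
    (h' : Leads E T l' U) : Leads E S (l ++ l') U := fun x hx => by
  rw [walk_append, getLastD_append']
  exact ⟨⟨(h x hx).1, (h' _ (h x hx).2).1⟩, (h' _ (h x hx).2).2⟩

/-- The list `l`, repeated `k` times. -/
def rep (k : ℕ) (l : List Label) : List Label := (List.replicate k l).flatten

theorem Leads.rep {E : List (Label × Label)} {S l : List Label} (h : Leads E S l S) (k : ℕ) :
    Leads E S (rep k l) S := by
  induction k with
  | zero => exact fun x hx => ⟨trivial, hx⟩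
  | succ k ih =>
    have : Seating.rep (k + 1) l = l ++ Seating.rep k l := by
      simp [Seating.rep, List.replicate_succ]
    rw [this]
    exact h.append ih

theorem countP_rep (p : Label → Bool) (k : ℕ) (l : List Label) :
    (rep k l).countP p = k * l.countP p := by
  simp [rep, List.countP_flatten]

/-- Local stability, tested on the walks of length two and three along `E`. The labels in `U` are
those that occupy at most one seat: if the walk through one label has such a label next to it, then
the seats of the two labels are adjacent, and the condition for non-adjacent seats is not needed. -/
def LocallyStable (M : Fin 3 → Fin 3 → ℤ) (E : List (Label × Label)) (U : List Label) : Prop :=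
  (∀ e ∈ E, ∀ e' ∈ E, e.2 = e'.1 → ∀ d ∈ E, ∀ d' ∈ E, d.2 = d'.1 → e.2.1 ≠ d.2.1 →
    (e.2 ∈ U → e.2 ≠ d.1 ∧ e.2 ≠ d'.2) → (d.2 ∈ U → d.2 ≠ e.1 ∧ d.2 ≠ e'.2) →
    ¬ (M e.2.1 e.1.1 + M e.2.1 e'.2.1 < M e.2.1 d.1.1 + M e.2.1 d'.2.1 ∧
       M d.2.1 d.1.1 + M d.2.1 d'.2.1 < M d.2.1 e.1.1 + M d.2.1 e'.2.1)) ∧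
  (∀ e ∈ E, ∀ e' ∈ E, e.2 = e'.1 → ∀ d ∈ E, e'.2 = d.1 → e.2.1 ≠ d.1.1 →
    ¬ (M e.2.1 e.1.1 < M e.2.1 d.2.1 ∧ M d.1.1 d.2.1 < M d.1.1 e.1.1))

set_option synthInstance.maxHeartbeats 200000 in
set_option synthInstance.maxSize 1024 in
instance (M : Fin 3 → Fin 3 → ℤ) (E : List (Label × Label)) (U : List Label) :
    Decidable (LocallyStable M E U) := by
  unfold LocallyStable
  infer_instance

/-- A word along a cyclic walk of a locally stable list of steps is stable. -/
theorem LocallyStable.wordStable {M : Fin 3 → Fin 3 → ℤ} {E : List (Label × Label)}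
    {U : List Label} (h : LocallyStable M E U) {m : ℕ} {w : Fin (m + 3) → Label}
    (hw : ∀ i, (w i, w (i + 1)) ∈ E) (hU : ∀ i j, w i ∈ U → w i = w j → i = j) :
    WordStable M fun i => (w i).1 := by
  have hw' : ∀ i, (w (i - 1), w i) ∈ E := fun i => by simpa using hw (i - 1)
  constructor
  · intro p q hs hq hp
    exact h.1 _ (hw' p) _ (hw p) rfl _ (hw' q) _ (hw q) rfl hs
      (fun hU' => ⟨fun e => hq (by rw [hU _ _ hU' e, sub_add_cancel]), fun e => hp (hU _ _ hU' e)⟩)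
      (fun hU' => ⟨fun e => hp (by rw [hU _ _ hU' e, sub_add_cancel]), fun e => hq (hU _ _ hU' e)⟩)
  · intro p hs
    exact h.2 _ (hw' p) _ (hw p) rfl _ (hw (p + 1)) rfl hs

theorem walk_getElem {E : List (Label × Label)} {x : Label} {l : List Label} (h : Walk E x l)
    (i : ℕ) (hi : i + 1 < l.length) : (l[i], l[i + 1]) ∈ E := by
  induction l generalizing x i with
  | nil => simp at hi
  | cons y l ih =>
    obtain ⟨-, h⟩ := h
    cases i with
    | zero =>
      cases l with
      | nil => simp at hi
      | cons z l => exact h.1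
    | succ i => exact ih h i (by simpa using hi)

theorem walk_getElem_zero {E : List (Label × Label)} {x : Label} {l : List Label} (h : Walk E x l)
    (hl : 0 < l.length) : (x, l[0]) ∈ E := by
  cases l with
  | nil => simp at hl
  | cons y l => exact h.1

/-- A list that leads from a nonempty set of labels back to this set is a cyclic walk. -/
theorem Leads.cyclic {E : List (Label × Label)} {S l : List Label} (h : Leads E S l S) (hS : S ≠ [])
    {m : ℕ} (hl : l.length = m + 3) (i : Fin (m + 3)) :
    (l.get (i.cast hl.symm), l.get ((i + 1).cast hl.symm)) ∈ E := by
  obtain ⟨x, hx⟩ := List.exists_mem_of_ne_nil S hS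
  have hy : l.getLastD x = l[m + 2] := by
    have : l.length - 1 = m + 2 := by omega
    rw [List.getLastD_eq_getLast?, List.getLast?_eq_getElem?, this]
    simp [hl]
  have hwalk := (h _ (h x hx).2).1
  rw [hy] at hwalk
  simp only [List.get_eq_getElem, Fin.val_cast]
  rcases eq_or_ne i (Fin.last (m + 2)) with rfl | hi
  · simpa using walk_getElem_zero hwalk (by omega)
  · have : (i + 1).val = i.val + 1 := Fin.val_add_one_of_lt (Fin.lt_last_iff_ne_last.2 hi)
    simp only [this]
    exact walk_getElem hwalk _ _

theorem card_subtype_get {α : Type*} (p : α → Bool) (l : List α) {n : ℕ} (hl : n = l.length) :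
    Fintype.card {i : Fin n // p (l.get (i.cast hl)) = true} = l.countP p := by
  subst hl
  have : (l : Multiset α) = Finset.univ.val.map l.get := by
    rw [Fin.univ_val_map, List.ofFn_get]
  have h : l.countP p = (l : Multiset α).countP (fun a => p a = true) := by
    simp
  rw [Fintype.card_subtype, h, this, Multiset.countP_map]
  rfl

/-- If a locally stable cyclic walk visits every class as often as this class has members, then some
arrangement has the letters of this walk as its word of classes, and this word is stable. -/
theorem exists_wordStable_of_leads {A : Type*} [Fintype A] {m : ℕ} {c : A → Fin 3}
    (hA : Fintype.card A = m + 3) {M : Fin 3 → Fin 3 → ℤ} {E : List (Label × Label)}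
    {U : List Label} (hE : LocallyStable M E U) {S l : List Label} (hS : S ≠ [])
    (hl : Leads E S l S) (hU : ∀ x ∈ U, l.countP (· = x) ≤ 1)
    (hc : ∀ s, l.countP (·.1 = s) = Fintype.card {a // c a = s}) :
    ∃ π : A ≃ Fin (m + 3), WordStable M (c ∘ π.symm) := by
  have hlen : l.length = m + 3 := by
    have h1 : l.length = ∑ s : Fin 3, l.countP (·.1 = s) := by
      clear hU hc hl
      induction l with
      | nil => simp
      | cons x l ih =>
        simp only [List.length_cons, List.countP_cons, Finset.sum_add_distrib, ← ih]
        simp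
    rw [h1, Finset.sum_congr rfl fun s _ => hc s, ← hA, ← Fintype.card_sigma]
    exact Fintype.card_congr (Equiv.sigmaFiberEquiv c)
  set w : Fin (m + 3) → Label := fun i => l.get (i.cast hlen.symm) with hw
  have hstable : WordStable M fun i => (w i).1 := by
    refine hE.wordStable (fun i => hl.cyclic hS hlen i) fun i j hi hij => ?_
    have h1 := hU _ hi
    rw [← card_subtype_get _ l hlen.symm, Fintype.card_le_one_iff_subsingleton] at h1
    have := h1.elim ⟨i, by simp [hw]⟩ ⟨j, by simpa [hw] using hij.symm⟩
    simpa using this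
  have e : ∀ s, Nonempty ({a // c a = s} ≃ {i // (w i).1 = s}) := fun s => by
    rw [← Fintype.card_eq, ← hc s, ← card_subtype_get _ l hlen.symm]
    simp [hw]
  refine ⟨Equiv.ofFiberEquiv fun s => (e s).some, ?_⟩
  convert hstable using 1
  funext i
  have := Equiv.ofFiberEquiv_map (fun s => (e s).some)
    ((Equiv.ofFiberEquiv fun s => (e s).some).symm i)
  rw [Equiv.apply_symm_apply] at this
  exact this.symm

/-! ### Stable words for cyclic preferences -/

/-- The matrix of three classes that like each other cyclically: class `0` likes class `1`, which
likes class `2`, which likes class `0`, and none of them likes the class it is liked by. The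
arguments are the values that the classes assign to themselves. -/
def cyclicMatrix (x y z : ℤ) : Fin 3 → Fin 3 → ℤ := ![![x, 1, 0], ![0, y, 1], ![1, 0, z]]

section Words

variable {A : Type*} [Fintype A] {m : ℕ} {c : A → Fin 3} {n₀ n₁ n₂ : ℕ}

/-- If class `0` is large, the members of the classes `1` and `2` are isolated among its members.
Then class `2` is content, and class `0` envies nobody of class `1`, whose neighbours all belong to
class `0`. -/
theorem exists_wordStable_cyclic_hub (hA : Fintype.card A = m + 3)
    (h₀ : Fintype.card {a // c a = 0} = n₀) (h₁ : Fintype.card {a // c a = 1} = n₁)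
    (h₂ : Fintype.card {a // c a = 2} = n₂) (h : n₁ + n₂ ≤ n₀) :
    ∃ π : A ≃ Fin (m + 3), WordStable (cyclicMatrix 0 0 0) (c ∘ π.symm) := by
  have hl : Leads [((0, 0), (0, 0)), ((0, 0), (1, 0)), ((1, 0), (0, 0)), ((0, 0), (2, 0)),
      ((2, 0), (0, 0))] [(0, 0), (1, 0), (2, 0)]
      (rep (n₀ - n₁ - n₂) [(0, 0)] ++ rep n₁ [(0, 0), (1, 0)] ++ rep n₂ [(0, 0), (2, 0)])
      [(0, 0), (1, 0), (2, 0)] :=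
    .append (.append (.rep (by decide) _) (.rep (by decide) _)) (.rep (by decide) _)
  refine exists_wordStable_of_leads hA (U := []) (by decide) (by simp) hl (by simp) fun s => ?_
  fin_cases s <;> simp [List.countP_append, countP_rep, h₀, h₁, h₂]
  omega

/-- A word without equal neighbours. Such a word is stable since an agent of class `s` envies a
member of class `s + 1` only if the latter sits next to its own class. -/
theorem exists_wordStable_cyclic_proper (hA : Fintype.card A = m + 3)
    (h₀ : Fintype.card {a // c a = 0} = n₀) (h₁ : Fintype.card {a // c a = 1} = n₁)
    (h₂ : Fintype.card {a // c a = 2} = n₂) (h : n₀ ≤ n₁ + n₂) (h01 : n₁ ≤ n₀) (h02 : n₂ ≤ n₀)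
    (p1 : 0 < n₁) :
    ∃ π : A ≃ Fin (m + 3), WordStable (cyclicMatrix 0 0 0) (c ∘ π.symm) := by
  let E : List (Label × Label) := [((0, 0), (1, 0)), ((1, 0), (0, 0)), ((0, 0), (2, 0)),
    ((2, 0), (0, 0)), ((1, 0), (2, 0)), ((2, 0), (1, 0))]
  have hE : LocallyStable (cyclicMatrix 0 0 0) E [] := by decide
  -- `ABC` occurs once if the number of agents is odd; `x`, `y`, `z` count `AB`, `AC`, `BC`
  obtain ⟨e, x, y, z, hx, hy, hz⟩ : ∃ e x y z : ℕ,
      n₀ = e + x + y ∧ n₁ = e + x + z ∧ n₂ = e + y + z := by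
    rcases Nat.even_or_odd' (n₀ + n₁ + n₂) with ⟨k, hk | hk⟩
    · exact ⟨0, k - n₂, k - n₁, k - n₀, by omega, by omega, by omega⟩
    · exact ⟨1, k - n₂, k - n₁, k - n₀, by omega, by omega, by omega⟩
  have hl : Leads E [(1, 0), (2, 0)] (rep e [(0, 0), (1, 0), (2, 0)] ++ rep x [(0, 0), (1, 0)] ++
      rep y [(0, 0), (2, 0)]) [(1, 0), (2, 0)] :=
    .append (.append (.rep (by decide) _) (.rep (by decide) _)) (.rep (by decide) _)
  rcases Nat.eq_zero_or_pos z with rfl | hz0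
  · refine exists_wordStable_of_leads hA (U := []) hE (by simp) hl (by simp) fun s => ?_
    fin_cases s <;> simp [List.countP_append, countP_rep, h₀, h₁, h₂] <;> omega
  · -- here `y` is positive as well, so that `BC` follows a `C`
    have hl' : Leads E [(1, 0), (2, 0)] (rep e [(0, 0), (1, 0), (2, 0)] ++
        rep x [(0, 0), (1, 0)] ++ rep (y - 1) [(0, 0), (2, 0)] ++ [(0, 0), (2, 0)] ++
        rep (z - 1) [(1, 0), (2, 0)] ++ [(1, 0), (2, 0)]) [(1, 0), (2, 0)] :=
      .append (T := [(2, 0)]) (.append (T := [(2, 0)]) (.append (T := [(1, 0), (2, 0)])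
        (.append (.append (.rep (by decide) _) (.rep (by decide) _)) (.rep (by decide) _))
        (by decide)) (.rep (by decide) _)) (by decide)
    refine exists_wordStable_of_leads hA (U := []) hE (by simp) hl' (by simp) fun s => ?_
    fin_cases s <;> simp [List.countP_append, countP_rep, h₀, h₁, h₂] <;> omega

/-- If all classes like themselves, the three classes sit in three blocks. At most the first agent
of each block, next to a disliked neighbour, is not content with both neighbours. -/
theorem exists_wordStable_cyclic_blocks (hA : Fintype.card A = m + 3)
    (h₀ : Fintype.card {a // c a = 0} = n₀) (h₁ : Fintype.card {a // c a = 1} = n₁)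
    (h₂ : Fintype.card {a // c a = 2} = n₂) (p0 : 0 < n₀) (p1 : 0 < n₁) (p2 : 0 < n₂) :
    ∃ π : A ≃ Fin (m + 3), WordStable (cyclicMatrix 1 1 1) (c ∘ π.symm) := by
  -- the tag `0` marks the first agent of a block
  have hl : Leads [((0, 0), (0, 1)), ((0, 0), (1, 0)), ((0, 1), (0, 1)), ((0, 1), (1, 0)),
      ((1, 0), (1, 1)), ((1, 0), (2, 0)), ((1, 1), (1, 1)), ((1, 1), (2, 0)),
      ((2, 0), (2, 1)), ((2, 0), (0, 0)), ((2, 1), (2, 1)), ((2, 1), (0, 0))] [(2, 0), (2, 1)]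
      ([(0, 0)] ++ rep (n₀ - 1) [(0, 1)] ++ [(1, 0)] ++ rep (n₁ - 1) [(1, 1)] ++
        [(2, 0)] ++ rep (n₂ - 1) [(2, 1)]) [(2, 0), (2, 1)] :=
    .append (.append (T := [(1, 0), (1, 1)]) (.append (.append (T := [(0, 0), (0, 1)])
      (.append (T := [(0, 0), (0, 1)]) (by decide) (.rep (by decide) _)) (by decide))
      (.rep (by decide) _)) (by decide)) (.rep (by decide) _)
  refine exists_wordStable_of_leads hA (U := [(0, 0), (1, 0), (2, 0)]) (by decide) (by simp) hl
    ?_ fun s => ?_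
  · simp [List.countP_append, countP_rep]
  · fin_cases s <;> simp [List.countP_append, countP_rep, h₀, h₁, h₂] <;> omega

/-- The word `A ⋯ A B ⋯ B A C ⋯ C`, for a class `0` of at least two agents that does not like
itself, while the other two classes like themselves. -/
theorem exists_wordStable_cyclic_split (hA : Fintype.card A = m + 3)
    (h₀ : Fintype.card {a // c a = 0} = n₀) (h₁ : Fintype.card {a // c a = 1} = n₁)
    (h₂ : Fintype.card {a // c a = 2} = n₂) (p0 : 2 ≤ n₀) (p1 : 0 < n₁) (p2 : 0 < n₂) :
    ∃ π : A ≃ Fin (m + 3), WordStable (cyclicMatrix 0 1 1) (c ∘ π.symm) := by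
  -- the tag `1` marks the separated agent of class `0`
  have hl : Leads [((0, 0), (0, 0)), ((0, 0), (1, 0)), ((1, 0), (1, 0)), ((1, 0), (0, 1)),
      ((0, 1), (2, 0)), ((2, 0), (2, 0)), ((2, 0), (0, 0))] [(2, 0)]
      ([(0, 0)] ++ rep (n₀ - 2) [(0, 0)] ++ [(1, 0)] ++ rep (n₁ - 1) [(1, 0)] ++
        [(0, 1), (2, 0)] ++ rep (n₂ - 1) [(2, 0)]) [(2, 0)] :=
    .append (.append (T := [(1, 0)]) (.append (.append (T := [(0, 0)])
      (.append (T := [(0, 0)]) (by decide) (.rep (by decide) _)) (by decide))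
      (.rep (by decide) _)) (by decide)) (.rep (by decide) _)
  refine exists_wordStable_of_leads hA (U := []) (by decide) (by simp) hl (by simp) fun s => ?_
  fin_cases s <;> simp [List.countP_append, countP_rep, h₀, h₁, h₂] <;> omega

/-- The case in which exactly the class `2` likes itself. -/
theorem exists_wordStable_cyclic_selfish (hA : Fintype.card A = m + 3)
    (h₀ : Fintype.card {a // c a = 0} = n₀) (h₁ : Fintype.card {a // c a = 1} = n₁)
    (h₂ : Fintype.card {a // c a = 2} = n₂) (p0 : 0 < n₀) (p2 : 0 < n₂) :
    ∃ π : A ≃ Fin (m + 3), WordStable (cyclicMatrix 0 0 1) (c ∘ π.symm) := by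
  rcases lt_trichotomy n₁ n₀ with h | h | h
  · -- `A ⋯ A B A B A ⋯ B A C ⋯ C`: everybody of class `2` is content, class `1` is isolated
    have hl : Leads [((0, 0), (0, 0)), ((0, 0), (1, 0)), ((1, 0), (0, 0)), ((0, 0), (2, 0)),
        ((2, 0), (2, 0)), ((2, 0), (0, 0))] [(2, 0)]
        ([(0, 0)] ++ rep (n₀ - n₁ - 1) [(0, 0)] ++ rep n₁ [(1, 0), (0, 0)] ++ [(2, 0)] ++
          rep (n₂ - 1) [(2, 0)]) [(2, 0)] :=
      .append (.append (T := [(0, 0)]) (.append (.append (T := [(0, 0)]) (by decide)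
        (.rep (by decide) _)) (.rep (by decide) _)) (by decide)) (.rep (by decide) _)
    refine exists_wordStable_of_leads hA (U := []) (by decide) (by simp) hl (by simp) fun s => ?_
    fin_cases s <;> simp [List.countP_append, countP_rep, h₀, h₁, h₂] <;> omega
  · subst h
    rcases le_total n₂ n₁ with h' | h'
    · -- `AB AB ⋯ AB ABC ABC ⋯ ABC`: equal letters do not meet, and no `A` lies between two `C`s
      have hl : Leads [((0, 0), (1, 0)), ((1, 0), (0, 0)), ((1, 0), (2, 0)), ((2, 0), (0, 0))]
          [(1, 0), (2, 0)]
          (rep (n₁ - n₂) [(0, 0), (1, 0)] ++ rep n₂ [(0, 0), (1, 0), (2, 0)])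
          [(1, 0), (2, 0)] :=
        .append (.rep (by decide) _) (.rep (by decide) _)
      refine exists_wordStable_of_leads hA (U := []) (by decide) (by simp) hl (by simp)
        fun s => ?_
      fin_cases s <;> simp [List.countP_append, countP_rep, h₀, h₁, h₂] <;> omega
    · -- `ABC ABC ⋯ ABC C ⋯ C`: everybody has a liked neighbour, and only class `2` has two of them
      have hl : Leads [((0, 0), (1, 0)), ((1, 0), (2, 0)), ((2, 0), (0, 0)), ((2, 0), (2, 0))]
          [(2, 0)] (rep n₁ [(0, 0), (1, 0), (2, 0)] ++ rep (n₂ - n₁) [(2, 0)]) [(2, 0)] :=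
        .append (.rep (by decide) _) (.rep (by decide) _)
      refine exists_wordStable_of_leads hA (U := []) (by decide) (by simp) hl (by simp)
        fun s => ?_
      fin_cases s <;> simp [List.countP_append, countP_rep, h₀, h₁, h₂]
      omega
  · rcases Nat.lt_or_ge n₂ 2 with h' | h'
    · -- the members of the classes `0` and `2` are isolated among those of class `1`
      have hl : Leads [((0, 0), (1, 0)), ((1, 0), (0, 0)), ((1, 0), (1, 0)), ((1, 0), (2, 0)),
          ((2, 0), (1, 0))] [(0, 0), (1, 0), (2, 0)]
          (rep (n₁ - n₀ - n₂) [(1, 0)] ++ rep n₀ [(1, 0), (0, 0)] ++ rep n₂ [(1, 0), (2, 0)])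
          [(0, 0), (1, 0), (2, 0)] :=
        .append (.append (.rep (by decide) _) (.rep (by decide) _)) (.rep (by decide) _)
      refine exists_wordStable_of_leads hA (U := []) (by decide) (by simp) hl (by simp)
        fun s => ?_
      fin_cases s <;> simp [List.countP_append, countP_rep, h₀, h₁, h₂]
      omega
    · -- `B (AABB) ⋯ (AABB) AA B ⋯ B C ⋯ C`, with `A` in place of the last `AA` for odd `n₀`;
      -- the class `2` forms a block between agents of class `1`, and `ABA`, `AAA` do not occur.
      -- Tags: `1`, `2` for the four letters of `AABB`, `3` for the first `B`, `4` for the single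
      -- `A`, `5` for the `B`s before the block; `0` for the first `C` and `1` for the others
      let E : List (Label × Label) := [((1, 3), (0, 1)), ((1, 3), (0, 4)), ((0, 1), (0, 2)),
        ((0, 2), (1, 1)), ((1, 1), (1, 2)), ((1, 2), (0, 1)), ((1, 2), (0, 4)), ((0, 2), (1, 5)),
        ((0, 4), (1, 5)), ((1, 5), (1, 5)), ((1, 5), (2, 0)), ((2, 0), (2, 1)), ((2, 1), (2, 1)),
        ((2, 1), (1, 3))]
      have hE : LocallyStable (cyclicMatrix 0 0 1) E [] := by decide
      have hend : ∀ j, Leads E [(0, 2), (0, 4), (1, 5)]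
          (rep j [(1, 5)] ++ [(1, 5), (2, 0)] ++ rep (n₂ - 2) [(2, 1)] ++ [(2, 1)]) [(2, 1)] :=
        fun j => .append (T := [(2, 0), (2, 1)])
          (.append (.append (T := [(0, 2), (0, 4), (1, 5)]) (.rep (by decide) _) (by decide))
            (.rep (by decide) _)) (by decide)
      have hstart : ∀ k, Leads E [(2, 1)] ([(1, 3)] ++ rep k [(0, 1), (0, 2), (1, 1), (1, 2)])
          [(1, 3), (1, 2)] :=
        fun k => .append (T := [(1, 3), (1, 2)]) (by decide) (.rep (by decide) _)
      rcases Nat.even_or_odd' n₀ with ⟨k, hk | hk⟩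
      · have hl := ((hstart (k - 1)).append (l' := [(0, 1), (0, 2)]) (by decide)).append
          (hend (n₁ - n₀))
        refine exists_wordStable_of_leads hA (U := []) hE (by simp) hl (by simp) fun s => ?_
        fin_cases s <;> simp [List.countP_append, countP_rep, h₀, h₁, h₂] <;> omega
      · have hl := ((hstart k).append (l' := [(0, 4)]) (by decide)).append (hend (n₁ - n₀ - 1))
        refine exists_wordStable_of_leads hA (U := []) hE (by simp) hl (by simp) fun s => ?_
        fin_cases s <;> simp [List.countP_append, countP_rep, h₀, h₁, h₂] <;> omega

end Words

/-! ### The matrix of preferences and the distinction of cases -/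

/-- The values of the preferences are determined by the classes of the two agents. -/
theorem eq_of_isClass {A κ : Type*} {P : Profile A} {c : A → κ}
    (hc : ∀ t, P.IsClass {i | c i = t}) {i j i' j' : A} (hij : i ≠ j) (hij' : i' ≠ j')
    (hi : c i = c i') (hj : c j = c j') : P i j = P i' j' := by
  obtain ⟨⟨p, hp, hp'⟩, -⟩ := hc (c i)
  by_cases h : c i = c j
  · rw [hp i rfl j hij.symm, hp i' hi.symm j' hij'.symm]
    exact hp' j h.symm j' (h.trans hj).symm
  · rw [hp i rfl j hij.symm, ← hp i' hi.symm j fun e => h (by rw [e, hi])]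
    exact (hc (c j)).2 i' (fun e => h (hi.trans e)) j rfl j' hj.symm

/-- The preferences of the classes of `c`, scaled to the values `0` and `1`. An entry that describes
no two agents, because a class is empty or because a class of one agent meets itself, is `1`. -/
structure IsPreferenceMatrix {A κ : Type*} (c : A → κ) (M : κ → κ → ℤ) : Prop where
  eq_zero_or_one : ∀ s t, M s t = 0 ∨ M s t = 1
  exists_of_eq_zero : ∀ s t, M s t = 0 → ∃ i j, i ≠ j ∧ c i = s ∧ c j = t

theorem exists_isPreferenceMatrix {A κ : Type*} {P : Profile A} {c : A → κ}
    (hc : ∀ t, P.IsClass {i | c i = t}) (hP : P.IsValued 2) :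
    ∃ (x y : ℝ) (M : κ → κ → ℤ), x < y ∧ IsPreferenceMatrix c M ∧
      ∀ i j, i ≠ j → P i j = x + (y - x) * M (c i) (c j) := by
  classical
  obtain ⟨x, y, hxy, hv⟩ : ∃ x y : ℝ, x < y ∧ ∀ i j, i ≠ j → P i j = x ∨ P i j = y := by
    obtain ⟨Γ, hΓ, hv⟩ := hP
    obtain ⟨x, y, hxy, rfl⟩ := Finset.card_eq_two.1 hΓ
    rcases lt_or_gt_of_ne hxy with h | h
    · exact ⟨x, y, h, fun i j hij => by simpa using hv i j hij⟩
    · exact ⟨y, x, h, fun i j hij => by simpa [or_comm] using hv i j hij⟩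
  refine ⟨x, y, fun s t => if ∃ i j, i ≠ j ∧ c i = s ∧ c j = t ∧ P i j = x then 0 else 1, hxy,
    ⟨fun s t => ?_, fun s t h => ?_⟩, fun i j hij => ?_⟩
  · split_ifs <;> simp
  · split_ifs at h with h'
    · obtain ⟨i, j, hij, hi, hj, -⟩ := h'
      exact ⟨i, j, hij, hi, hj⟩
    · exact absurd h one_ne_zero
  · dsimp only
    split_ifs with h
    · obtain ⟨i', j', hij', hi, hj, h⟩ := h
      rw [eq_of_isClass hc hij hij' hi.symm hj.symm, h]
      simp
    · have := (hv i j hij).resolve_left fun e => h ⟨i, j, hij, rfl, rfl, e⟩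
      rw [this]
      simp

theorem IsPreferenceMatrix.relabel {A κ : Type*} {c : A → κ} {M : κ → κ → ℤ}
    (h : IsPreferenceMatrix c M) (e : Equiv.Perm κ) :
    IsPreferenceMatrix (e ∘ c) fun s t => M (e.symm s) (e.symm t) where
  eq_zero_or_one _ _ := h.eq_zero_or_one _ _
  exists_of_eq_zero _ _ h' := by
    obtain ⟨i, j, hij, hi, hj⟩ := h.exists_of_eq_zero _ _ h'
    exact ⟨i, j, hij, by simp [hi], by simp [hj]⟩

theorem exists_wordStable_of_relabel {A κ : Type*} {m : ℕ} {c : A → κ} {M : κ → κ → ℤ}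
    (e : Equiv.Perm κ) (h : ∃ π : A ≃ Fin (m + 3),
      WordStable (fun s t => M (e.symm s) (e.symm t)) ((e ∘ c) ∘ π.symm)) :
    ∃ π : A ≃ Fin (m + 3), WordStable M (c ∘ π.symm) := by
  obtain ⟨π, h⟩ := h
  exact ⟨π, by simpa [WordStable] using h⟩

theorem card_relabel {A κ : Type*} [Fintype A] [DecidableEq κ] (c : A → κ) (e : Equiv.Perm κ)
    (s : κ) :
    Fintype.card {a // (e ∘ c) a = s} = Fintype.card {a // c a = e.symm s} :=
  Fintype.card_congr (Equiv.subtypeEquivRight fun a => by simp [Equiv.eq_symm_apply])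

/-- The cyclic rotation of the three classes that makes the class `s` the class `0`. -/
abbrev rotation (s : Fin 3) : Equiv.Perm (Fin 3) := Equiv.subRight s

/-- The cyclic case: every class `s` prefers the class `s + 1` to the class `s + 2`. -/
theorem exists_wordStable_of_cyclic {A : Type*} [Fintype A] {m : ℕ} {c : A → Fin 3}
    (hA : Fintype.card A = m + 3) {M : Fin 3 → Fin 3 → ℤ} (hM : IsPreferenceMatrix c M)
    (h : ∀ s, M s (s + 1) = 1 ∧ M s (s + 2) = 0) :
    ∃ π : A ≃ Fin (m + 3), WordStable M (c ∘ π.symm) := by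
  have hpos : ∀ s, 0 < Fintype.card {a // c a = s} := fun s => by
    obtain ⟨i, -, -, hi, -⟩ := hM.exists_of_eq_zero _ _ (h s).2
    exact Fintype.card_pos_iff.2 ⟨⟨i, hi⟩⟩
  have htwo : ∀ s, M s s = 0 → 2 ≤ Fintype.card {a // c a = s} := fun s hs => by
    obtain ⟨i, j, hij, hi, hj⟩ := hM.exists_of_eq_zero _ _ hs
    exact Fintype.one_lt_card_iff.2 ⟨⟨i, hi⟩, ⟨j, hj⟩, by simpa using hij⟩
  have hrot : ∀ r, (fun s t => M ((rotation r).symm s) ((rotation r).symm t)) =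
      cyclicMatrix (M r r) (M (r + 1) (r + 1)) (M (r + 2) (r + 2)) := by
    intro r
    have h0 := h 0
    have h1 := h 1
    have h2 := h 2
    funext s t
    fin_cases r <;> fin_cases s <;> fin_cases t <;>
      simp_all [cyclicMatrix, rotation]
  have hcard : ∀ r s, Fintype.card {a // (rotation r ∘ c) a = s} =
      Fintype.card {a // c a = s + r} := fun r s => card_relabel c _ s
  have hall : M 0 0 = 1 → M 1 1 = 1 → M 2 2 = 1 →
      ∃ π : A ≃ Fin (m + 3), WordStable M (c ∘ π.symm) := by
    intro d0 d1 d2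
    refine exists_wordStable_of_relabel (rotation 0) ?_
    rw [hrot]
    simp only [zero_add, d0, d1, d2]
    exact exists_wordStable_cyclic_blocks hA (hcard 0 0) (hcard 0 1) (hcard 0 2) (hpos _) (hpos _)
      (hpos _)
  have hsplit : ∀ r, M r r = 0 → M (r + 1) (r + 1) = 1 → M (r + 2) (r + 2) = 1 →
      ∃ π : A ≃ Fin (m + 3), WordStable M (c ∘ π.symm) := by
    intro r d0 d1 d2
    refine exists_wordStable_of_relabel (rotation r) ?_
    rw [hrot, d0, d1, d2]
    exact exists_wordStable_cyclic_split hA (hcard r 0) (hcard r 1) (hcard r 2)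
      (by simpa using htwo r d0) (hpos _) (hpos _)
  have hselfish : ∀ r, M r r = 0 → M (r + 1) (r + 1) = 0 → M (r + 2) (r + 2) = 1 →
      ∃ π : A ≃ Fin (m + 3), WordStable M (c ∘ π.symm) := by
    intro r d0 d1 d2
    refine exists_wordStable_of_relabel (rotation r) ?_
    rw [hrot, d0, d1, d2]
    exact exists_wordStable_cyclic_selfish hA (hcard r 0) (hcard r 1) (hcard r 2) (hpos _) (hpos _)
  have hnone : M 0 0 = 0 → M 1 1 = 0 → M 2 2 = 0 →
      ∃ π : A ≃ Fin (m + 3), WordStable M (c ∘ π.symm) := by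
    intro d0 d1 d2
    have d : ∀ s, M s s = 0 := fun s => by fin_cases s <;> assumption
    -- the class `r` is a largest one
    obtain ⟨r, hr⟩ := Finite.exists_max fun s => Fintype.card {a // c a = s}
    refine exists_wordStable_of_relabel (rotation r) ?_
    rw [hrot, d, d, d]
    rcases le_total (Fintype.card {a // c a = 1 + r} + Fintype.card {a // c a = 2 + r})
      (Fintype.card {a // c a = 0 + r}) with hle | hle
    · exact exists_wordStable_cyclic_hub hA (hcard r 0) (hcard r 1) (hcard r 2) hle
    · exact exists_wordStable_cyclic_proper hA (hcard r 0) (hcard r 1) (hcard r 2) hle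
        (by simpa using hr (1 + r)) (by simpa using hr (2 + r)) (hpos _)
  rcases hM.eq_zero_or_one 0 0 with d0 | d0 <;> rcases hM.eq_zero_or_one 1 1 with d1 | d1 <;>
    rcases hM.eq_zero_or_one 2 2 with d2 | d2
  · exact hnone d0 d1 d2
  · exact hselfish 0 d0 d1 d2
  · exact hselfish 2 d2 d0 d1
  · exact hsplit 0 d0 d1 d2
  · exact hselfish 1 d1 d2 d0
  · exact hsplit 1 d1 d2 d0
  · exact hsplit 2 d2 d0 d1
  · exact hall d0 d1 d2

/-- Every class tells the other two classes apart in one of two ways, unless it makes no difference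
between them. Only if all three classes choose the same cyclic direction there is no potential. -/
theorem exists_wordStable {A : Type*} [Fintype A] {m : ℕ} {c : A → Fin 3}
    (hA : Fintype.card A = m + 3) {M : Fin 3 → Fin 3 → ℤ} (hM : IsPreferenceMatrix c M) :
    ∃ π : A ≃ Fin (m + 3), WordStable M (c ∘ π.symm) := by
  have hA' : Nonempty (A ≃ Fin (m + 3)) := ⟨Fintype.equivFinOfCardEq hA⟩
  have hM' := hM.eq_zero_or_one
  by_cases h : ∃ s, M s (s + 1) = M s (s + 2)
  · obtain ⟨s, hs⟩ := h
    refine exists_wordStable_of_relabel (rotation s)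
      (exists_wordStable_of_eq hA' (fun a b => ?_) ?_)
    · rcases hM' (a + s) (b + s) with e | e <;> simp [e]
    · simpa [rotation, add_comm] using hs
  push Not at h
  have hd : ∀ s, (M s (s + 1) = 1 ∧ M s (s + 2) = 0) ∨ (M s (s + 1) = 0 ∧ M s (s + 2) = 1) := by
    intro s
    have := h s
    rcases hM' s (s + 1) with e | e <;> rcases hM' s (s + 2) with e' | e' <;> simp_all
  -- the class `s` prefers the cyclic direction that the other two classes do not prefer
  have hodd : ∀ s, 2 * (M s (s + 1) - M s (s + 2)) + (M (s + 1) (s + 2) - M (s + 1) s) +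
      (M (s + 2) s - M (s + 2) (s + 1)) = 0 →
      ∃ π : A ≃ Fin (m + 3), WordStable M (c ∘ π.symm) := by
    intro s hs
    refine exists_wordStable_of_relabel (rotation s) (exists_wordStable_of_balanced hA' ?_)
    simpa [rotation, add_comm] using hs
  have hd0 := hd 0
  have hd1 := hd 1
  have hd2 := hd 2
  simp only [Fin.isValue, zero_add, Fin.reduceAdd] at hd0 hd1 hd2
  rcases hd0 with ⟨e0, e0'⟩ | ⟨e0, e0'⟩ <;> rcases hd1 with ⟨e1, e1'⟩ | ⟨e1, e1'⟩ <;>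
    rcases hd2 with ⟨e2, e2'⟩ | ⟨e2, e2'⟩
  · exact exists_wordStable_of_cyclic hA hM fun s => by fin_cases s <;> simp [*]
  · exact hodd 2 (by simp [*])
  · exact hodd 1 (by simp [*])
  · exact hodd 0 (by simp [*])
  · exact hodd 0 (by simp [*])
  · exact hodd 1 (by simp [*])
  · exact hodd 2 (by simp [*])
  · -- reversing the cyclic order of the classes reduces this to the previous cyclic case
    refine exists_wordStable_of_relabel (Equiv.swap 1 2)
      (exists_wordStable_of_cyclic hA (hM.relabel _) fun s => ?_)
    have s0 : Equiv.swap (1 : Fin 3) 2 0 = 0 := by decide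
    fin_cases s <;> simp [*]

end Seating

theorem mainTheorem1 {A : Type*} [Fintype A] [DecidableEq A] (P : Seating.Profile A)
    (hvalues : P.IsValued 2) (hclasses : P.HasClasses 3) :
    ∃ π : A ≃ Fin (Fintype.card A),
      Seating.IsStable P (SimpleGraph.cycleGraph (Fintype.card A)) π := by
  generalize hn : Fintype.card A = n
  rcases Nat.lt_or_ge n 3 with h | h
  · exact ⟨Fintype.equivFinOfCardEq hn, Seating.isStable_cycleGraph_of_lt_three h P _⟩
  · obtain ⟨m, rfl⟩ := Nat.exists_eq_add_of_le' h
    obtain ⟨c, hc⟩ := hclasses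
    obtain ⟨x, y, M, hxy, hM, hP⟩ := Seating.exists_isPreferenceMatrix hc hvalues
    obtain ⟨π, hπ⟩ := Seating.exists_wordStable hn hM
    exact ⟨π, Seating.isStable_of_wordStable hxy hP π hπ⟩
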